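/- Let $p$ be a prime and let $G$ be a finite $p$-group of maximal class with $|G| = p^n$, that is, $G$ has nilpotency class $n-1$ (and $n \ge 2$). For an irreducible complex character $\chi$ of $G$ let $\operatorname{cod}(\chi) = |G : \ker\chi| / \chi(1)$ be its codegree, and put $\operatorname{cd}(G) = \{\chi(1) : \chi \in \operatorname{Irr}(G)\}$ and $\operatorname{cod}(G) = \{\operatorname{cod}(\chi) : \chi \in \operatorname{Irr}(G)\}$. If $\operatorname{cd}(G) = \{1, p, p^b\}$ for some integer $b \ge 2$, then $\operatorname{cod}(G) = \{p^i : 0 \le i \le c\}$ for some integer $c$ with $n - b \le c \le n - 2$. -/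

import Mathlib

/-- `cd(G) = {χ(1) : χ ∈ Irr(G)}`, the set of degrees of the irreducible complex characters of a
finite group `G`: the dimensions of the irreducible finite-dimensional complex representations. -/
def characterDegrees (G : Type*) [Group G] : Set ℕ :=
  {d | ∃ (V : Type) (_ : AddCommGroup V) (_ : Module ℂ V) (_ : FiniteDimensional ℂ V)
      (ρ : Representation ℂ G V), ρ.IsIrreducible ∧ d = Module.finrank ℂ V}

/-- The codegree `|G : ker χ| / χ(1)` of the character `χ` afforded by the representation `ρ`;
here `χ(1) = dim V` (`Representation.char_one`), and `ker χ = {g | χ(g) = χ(1)}` is the kernel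
of `ρ` (`mem_ker_iff_character_eq` below). The quotient is taken in `ℚ`. -/
noncomputable def Representation.codegree {G V : Type*} [Group G] [AddCommGroup V] [Module ℂ V]
    (ρ : Representation ℂ G V) : ℚ :=
  ((MonoidHom.ker ρ).index : ℚ) / (Module.finrank ℂ V : ℚ)

/-- `cod(G)`, the set of codegrees of the irreducible complex characters of `G`. -/
def characterCodegrees (G : Type*) [Group G] : Set ℚ :=
  {q | ∃ (V : Type) (_ : AddCommGroup V) (_ : Module ℂ V) (_ : FiniteDimensional ℂ V)
      (ρ : Representation ℂ G V), ρ.IsIrreducible ∧ q = ρ.codegree}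

/-- `G` is a `p`-group of maximal class: it has order `p ^ n` and nilpotency class `n - 1`
for some `n ≥ 2`. -/
def IsMaximalClassPGroup (p : ℕ) (G : Type*) [Group G] : Prop :=
  ∃ n : ℕ, 2 ≤ n ∧ Nat.card G = p ^ n ∧ Group.nilpotencyClass G = n - 1

/-- The kernel of a representation of a finite group is the kernel `{g | χ(g) = χ(1)}` of its
character. -/
theorem mem_ker_iff_character_eq {G V : Type*} [Group G] [Finite G] [AddCommGroup V] [Module ℂ V]
    [FiniteDimensional ℂ V] (ρ : Representation ℂ G V) (g : G) :
    g ∈ MonoidHom.ker ρ ↔ ρ.character g = ρ.character 1 := by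
  constructor
  · intro h
    rw [MonoidHom.mem_ker] at h
    simp [Representation.character, h]
  intro h
  rw [MonoidHom.mem_ker]
  rw [Representation.char_one, Representation.character] at h
  have hn : Nat.card G ≠ 0 := Nat.card_pos.ne'
  generalize hf : ρ g = f at h ⊢
  have hpow : f ^ Nat.card G = 1 := by rw [← hf, ← map_pow, pow_card_eq_one', map_one]
  generalize Nat.card G = n at hn hpow
  have hspl : f.charpoly.Splits := IsAlgClosed.splits _
  rw [Module.End.trace_eq_sum_roots_charpoly_of_splits hspl] at h
  have hcard : f.charpoly.roots.card = Module.finrank ℂ V := by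
    rw [← LinearMap.charpoly_natDegree f]
    exact hspl.natDegree_eq_card_roots.symm
  -- every eigenvalue has modulus one
  have hroot : ∀ z ∈ f.charpoly.roots, ‖z‖ = 1 := by
    intro z hz
    have hz' : Module.End.HasEigenvalue f z :=
      (Module.End.hasEigenvalue_iff_isRoot_charpoly f z).2 (Polynomial.isRoot_of_mem_roots hz)
    obtain ⟨v, hv⟩ := hz'.exists_hasEigenvector
    have h1 := hv.pow_apply n
    rw [hpow] at h1
    have h2 : (z ^ n - 1) • v = 0 := by
      rw [sub_smul, ← h1]; simp
    have h3 : z ^ n = 1 := by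
      rcases smul_eq_zero.1 h2 with h | h
      · exact sub_eq_zero.1 h
      · exact absurd h hv.2
    exact Complex.norm_eq_one_of_pow_eq_one h3 hn
  have hone : ∀ z ∈ f.charpoly.roots, z = 1 := by
    have hsum : (f.charpoly.roots.map (fun z => 1 - z.re)).sum = 0 := by
      rw [Multiset.sum_map_sub]
      have : (f.charpoly.roots.map Complex.re).sum = f.charpoly.roots.sum.re :=
        (map_multiset_sum Complex.reAddGroupHom _).symm
      simp [this, h, hcard]
    have hnn : ∀ x ∈ f.charpoly.roots.map (fun z => 1 - z.re), 0 ≤ x := by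
      intro x hx
      obtain ⟨z, hz, rfl⟩ := Multiset.mem_map.1 hx
      have := Complex.re_le_norm z
      rw [hroot z hz] at this
      linarith
    intro z hz
    have hz1 : 1 - z.re = 0 := Multiset.all_zero_of_le_zero_le_of_sum_eq_zero hnn hsum
      _ (Multiset.mem_map_of_mem (fun z : ℂ => 1 - z.re) hz)
    have hre : z.re = 1 := by linarith
    have hsq := Complex.sq_norm z
    rw [hroot z hz, Complex.normSq_apply, hre] at hsq
    have him : z.im = 0 := by nlinarith
    exact Complex.ext (by simpa using hre) (by simpa using him)
  have hchar : f.charpoly = (Polynomial.X - Polynomial.C 1) ^ Module.finrank ℂ V := by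
    have h1 : f.charpoly.roots = Multiset.replicate (Module.finrank ℂ V) 1 :=
      Multiset.eq_replicate.2 ⟨hcard, hone⟩
    have h2 := hspl.eq_prod_roots_of_monic (LinearMap.charpoly_monic f)
    rw [h1] at h2
    simpa using h2
  have hnil : IsNilpotent (f - 1) := by
    refine ⟨Module.finrank ℂ V, ?_⟩
    have := LinearMap.aeval_self_charpoly f
    rw [hchar] at this
    simpa using this
  have hss : Module.End.IsSemisimple f := by
    refine Module.End.isSemisimple_of_squarefree_aeval_eq_zero (p := Polynomial.X ^ n - 1) ?_ ?_
    · exact (Polynomial.X_pow_sub_one_separable_iff.2 (by exact_mod_cast hn)).squarefree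
    · simp [hpow]
  have hss' : Module.End.IsSemisimple (f - 1) := by
    simpa using (Module.End.isSemisimple_sub_algebraMap_iff (f := f) (μ := (1 : ℂ))).2 hss
  exact sub_eq_zero.1 (Module.End.eq_zero_of_isNilpotent_isSemisimple hnil hss')

/-! Write `γ_m` for `(⊤ : Subgroup G).lowerCentralSeries (m - 1)`. In a group of maximal class `γ_m`
has index `p ^ m` for `2 ≤ m ≤ n`, and every normal subgroup of index `p ^ m` with `m ≥ 2` is `γ_m`.
So kernels of nonlinear irreducible characters form a chain, and each `γ_m` with `3 ≤ m ≤ n` is such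
a kernel. Kernels of linear characters have index `1` or `p`.

Degree `p` is inherited upwards. If `ρ` is irreducible of degree `p`, some subgroup of index `p` is
abelian modulo `ker ρ`, so every irreducible character whose kernel contains `ker ρ` has degree at
most `p`. Let `M` be the largest exponent for which `γ_M` is the kernel of a character of degree
`p`. Nonlinear characters with kernel `γ_m` then have degree `p` for `m ≤ M` and degree `p ^ b` for
`m > M`.

The exponents of the codegrees are therefore `0`, `1`, the interval from `2` to `M - 1`, and the
interval from `M + 1 - b` to `n - b`. As `b ≥ 2`, no gap remains, and `c = max (M - 1) (n - b)`. A
character of degree `p ^ b` exists, so `M < n` and `c ≤ n - 2`. -/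

open scoped commutatorElement

/-! ### Common eigenvectors of commuting operators -/

open Module in
/-- Commuting operators on a nonzero finite-dimensional complex vector space have a common
eigenvector. -/
theorem Module.End.exists_common_eigenvector {V ι : Type*} [AddCommGroup V] [Module ℂ V]
    [FiniteDimensional ℂ V] [Nontrivial V] (f : ι → Module.End ℂ V)
    (hf : ∀ i j, Commute (f i) (f j)) :
    ∃ v : V, v ≠ 0 ∧ ∀ i, ∃ c : ℂ, f i v = c • v := by
  suffices H : ∀ (d : ℕ) (W : Submodule ℂ V), finrank ℂ W = d → W ≠ ⊥ →
      (∀ i, ∀ w ∈ W, f i w ∈ W) → ∃ v : V, v ≠ 0 ∧ ∀ i, ∃ c : ℂ, f i v = c • v from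
    H _ ⊤ rfl top_ne_bot (by simp)
  intro d
  induction d using Nat.strong_induction_on with
  | _ d ih =>
    intro W hWd hW hfW
    by_cases hsc : ∀ i, ∃ c : ℂ, ∀ w ∈ W, f i w = c • w
    · obtain ⟨v, hvW, hv⟩ := Submodule.exists_mem_ne_zero_of_ne_bot hW
      exact ⟨v, hv, fun i => (hsc i).imp fun c hc => hc v hvW⟩
    push Not at hsc
    obtain ⟨i, hi⟩ := hsc
    have : Nontrivial W := (Submodule.nontrivial_iff_ne_bot).2 hW
    obtain ⟨c, hc⟩ := Module.End.exists_eigenvalue ((f i).restrict (hfW i))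
    obtain ⟨u, hu⟩ := hc.exists_hasEigenvector
    have hu1 : f i u = c • (u : V) := congrArg Subtype.val hu.apply_eq_smul
    obtain ⟨w, hwW, hw⟩ := hi c
    -- Some `f i` is not scalar on `W`, so its eigenspace cuts `W` down properly; the other
    -- operators preserve it because they commute with `f i`.
    have hlt : W ⊓ (f i).eigenspace c < W := by
      refine lt_of_le_of_ne inf_le_left fun h => hw ?_
      rw [← h] at hwW
      exact Module.End.mem_eigenspace_iff.1 hwW.2
    refine ih _ (hWd ▸ Submodule.finrank_lt_finrank_of_lt hlt) _ rfl ?_ ?_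
    · refine (Submodule.ne_bot_iff _).2 ⟨u, ⟨u.2, Module.End.mem_eigenspace_iff.2 hu1⟩, ?_⟩
      exact fun h => hu.2 (Subtype.ext h)
    · rintro j x ⟨hxW, hx⟩
      refine ⟨hfW j x hxW, Module.End.mem_eigenspace_iff.2 ?_⟩
      have hx' := Module.End.mem_eigenspace_iff.1 hx
      have := congrArg (fun g => g x) (hf i j).eq
      simp only [Module.End.mul_apply] at this
      rw [this, hx', map_smul]

/-! ### Degrees of irreducible representations and subgroups with abelian image -/

namespace Representation

variable {G V : Type*} [Group G] [AddCommGroup V] [Module ℂ V]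

theorem IsIrreducible.nontrivial_space {ρ : Representation ℂ G V} (hρ : ρ.IsIrreducible) :
    Nontrivial V := by
  by_contra h
  rw [not_nontrivial_iff_subsingleton] at h
  refine bot_ne_top (α := Subrepresentation ρ) (Subrepresentation.toSubmodule_injective ?_)
  exact Subsingleton.elim _ _

theorem IsIrreducible.submodule_eq_top {ρ : Representation ℂ G V} (hρ : ρ.IsIrreducible)
    (W : Submodule ℂ V) (hW : W ≠ ⊥) (hinv : ∀ g, ∀ w ∈ W, ρ g w ∈ W) : W = ⊤ := by
  rcases eq_bot_or_eq_top (⟨W, fun g _ h => hinv g _ h⟩ : Subrepresentation ρ) with h | h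
  · exact absurd (congrArg Subrepresentation.toSubmodule h) hW
  · exact congrArg Subrepresentation.toSubmodule h

/-- Schur's lemma for operators in the image of the representation. -/
theorem IsIrreducible.exists_eq_smul [FiniteDimensional ℂ V] {ρ : Representation ℂ G V}
    (hρ : ρ.IsIrreducible) (z : G) (hz : ∀ g, Commute (ρ z) (ρ g)) :
    ∃ c : ℂ, ∀ v, ρ z v = c • v := by
  have := hρ.nontrivial_space
  obtain ⟨c, hc⟩ := Module.End.exists_eigenvalue (ρ z)
  refine ⟨c, fun v => ?_⟩
  have htop := hρ.submodule_eq_top (Module.End.eigenspace (ρ z) c) hc (by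
    intro g w hw
    rw [Module.End.mem_eigenspace_iff] at hw ⊢
    have := congrArg (fun f => f w) (hz g).eq
    simp only [Module.End.mul_apply] at this
    rw [this, hw, map_smul])
  exact Module.End.mem_eigenspace_iff.1 (htop ▸ Submodule.mem_top)

theorem commute_of_commutator_mem_ker (ρ : Representation ℂ G V) {g h : G}
    (H : ⁅g, h⁆ ∈ MonoidHom.ker ρ) : Commute (ρ g) (ρ h) := by
  have h1 : g * h = ⁅g, h⁆ * (h * g) := by group
  rw [MonoidHom.mem_ker] at H
  rw [commute_iff_eq, ← map_mul, h1, map_mul, H, one_mul, map_mul]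

theorem commutator_mem_ker_of_commute (ρ : Representation ℂ G V) {g h : G}
    (H : Commute (ρ g) (ρ h)) : ⁅g, h⁆ ∈ MonoidHom.ker ρ := by
  have h1 : ⁅g, h⁆ = g * h * (h * g)⁻¹ := by group
  rw [MonoidHom.mem_ker, h1, map_mul, map_mul, H.eq, ← map_mul, ← map_mul, mul_inv_cancel, map_one]

/-- If `H` acts by commuting operators then the degree of an irreducible representation is at most
the index of `H`. -/
theorem IsIrreducible.finrank_le_index [Finite G] [FiniteDimensional ℂ V]
    {ρ : Representation ℂ G V} (hρ : ρ.IsIrreducible) (H : Subgroup G)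
    (hH : ⁅H, H⁆ ≤ MonoidHom.ker ρ) : Module.finrank ℂ V ≤ H.index := by
  have := hρ.nontrivial_space
  obtain ⟨v, hv, hvc⟩ := Module.End.exists_common_eigenvector (fun h : H => ρ h) fun i j =>
    ρ.commute_of_commutator_mem_ker (hH (Subgroup.commutator_mem_commutator i.2 j.2))
  have := Fintype.ofFinite (G ⧸ H)
  -- Since `H` acts on `v` by scalars, the line through `ρ g v` depends only on the coset of `g`.
  -- These lines span an invariant subspace of dimension at most the index of `H`.
  let f : G ⧸ H → V := fun q => ρ q.out v
  have hmem : ∀ g : G, ρ g v ∈ Submodule.span ℂ (Set.range f) := by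
    intro g
    obtain ⟨h, hh⟩ := QuotientGroup.mk_out_eq_mul H g
    obtain ⟨c, hc⟩ := hvc h⁻¹
    have : ρ g v = c • f (g : G ⧸ H) := by
      change ρ g v = c • ρ (g : G ⧸ H).out v
      rw [← map_smul, ← hc, ← Module.End.mul_apply, ← map_mul, hh]
      simp
    rw [this]
    exact Submodule.smul_mem _ _ (Submodule.subset_span ⟨_, rfl⟩)
  have htop := hρ.submodule_eq_top (Submodule.span ℂ (Set.range f))
    ((Submodule.ne_bot_iff _).2 ⟨v, by simpa using hmem 1, hv⟩) (by
      intro g w hw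
      induction hw using Submodule.span_induction with
      | mem x hx =>
        obtain ⟨q, rfl⟩ := hx
        change ρ g (ρ q.out v) ∈ _
        rw [← Module.End.mul_apply, ← map_mul]
        exact hmem _
      | zero => simp
      | add x y _ _ hx hy => rw [map_add]; exact add_mem hx hy
      | smul c x _ hx => rw [map_smul]; exact Submodule.smul_mem _ _ hx)
  have h1 := finrank_range_le_card (R := ℂ) f
  rw [Set.finrank, htop, finrank_top] at h1
  rwa [Subgroup.index, Nat.card_eq_fintype_card]

theorem IsIrreducible.finrank_eq_one_of_commutator_le_ker [Finite G] [FiniteDimensional ℂ V]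
    {ρ : Representation ℂ G V} (hρ : ρ.IsIrreducible) (h : commutator G ≤ MonoidHom.ker ρ) :
    Module.finrank ℂ V = 1 := by
  have := hρ.nontrivial_space
  have h1 := hρ.finrank_le_index ⊤ h
  rw [Subgroup.index_top] at h1
  exact le_antisymm h1 Module.finrank_pos

theorem commute_of_finrank_eq_one (ρ : Representation ℂ G V)
    (h : Module.finrank ℂ V = 1) (g k : G) : Commute (ρ g) (ρ k) := by
  obtain ⟨a, ha, -⟩ := LinearMap.existsUnique_eq_smul_id_of_finrank_eq_one h (ρ g)
  rw [ha]
  exact Algebra.commute_algebraMap_left a (ρ k)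

theorem commutator_le_ker_of_finrank_eq_one (ρ : Representation ℂ G V)
    (h : Module.finrank ℂ V = 1) : commutator G ≤ MonoidHom.ker ρ := by
  rw [commutator_def, Subgroup.commutator_le]
  exact fun g _ k _ => ρ.commutator_mem_ker_of_commute (ρ.commute_of_finrank_eq_one h g k)

/-- An operator with a basis of eigenvectors with distinct eigenvalues has a commutative
centralizer. -/
theorem _root_.Module.Basis.commute_of_injective_eigenvalues {ι : Type*} [Fintype ι]
    (B : Module.Basis ι ℂ V) (a : Module.End ℂ V) (μ : ι → ℂ) (hμ : Function.Injective μ)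
    (ha : ∀ i, a (B i) = μ i • B i) {x y : Module.End ℂ V} (hx : Commute x a) (hy : Commute y a) :
    Commute x y := by
  have hrepr : ∀ u j, B.repr (a u) j = μ j * B.repr u j := by
    classical
    intro u j
    have : (B.coord j) ∘ₗ a = μ j • B.coord j := by
      refine B.ext fun i => ?_
      by_cases hij : i = j
      · simp [ha, hij]
      · simp [ha, hij]
    exact congrArg (fun f => f u) this
  -- Whatever commutes with `a` preserves its eigenspaces, which are lines, so it is diagonal in
  -- `B`.
  have key : ∀ z : Module.End ℂ V, Commute z a → ∀ i, ∃ c : ℂ, z (B i) = c • B i := by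
    intro z hz i
    refine ⟨B.repr (z (B i)) i, B.repr.injective (Finsupp.ext fun j => ?_)⟩
    by_cases hij : i = j
    · simp [hij]
    have h1 := hrepr (z (B i)) j
    rw [← Module.End.mul_apply, ← hz.eq, Module.End.mul_apply, ha, map_smul, map_smul] at h1
    have h2 : (μ i - μ j) * B.repr (z (B i)) j = 0 := by
      rw [sub_mul, sub_eq_zero]; simpa using h1
    have h3 := (mul_eq_zero.1 h2).resolve_left (sub_ne_zero.2 fun h => hij (hμ h))
    simp [h3, hij]
  refine B.ext fun i => ?_
  obtain ⟨c, hc⟩ := key x hx i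
  obtain ⟨d, hd⟩ := key y hy i
  simp only [Module.End.mul_apply, hc, hd, map_smul]
  rw [smul_comm]

end Representation

/-- A noncommutative `p`-group has a noncentral element that is central modulo the center. -/
theorem IsPGroup.exists_commutator_mem_center {p : ℕ} [Fact p.Prime] {Q : Type*} [Group Q]
    [Finite Q] (hQ : IsPGroup p Q) (hc : Subgroup.center Q ≠ ⊤) :
    ∃ a ∉ Subgroup.center Q, ∀ g, ⁅a, g⁆ ∈ Subgroup.center Q := by
  have : Nontrivial (Q ⧸ Subgroup.center Q) := by
    rw [← not_subsingleton_iff_nontrivial]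
    exact fun h => hc (QuotientGroup.subsingleton_iff.1 h)
  have hn := (hQ.to_quotient (Subgroup.center Q)).center_nontrivial
  obtain ⟨⟨x, hx⟩, hx1⟩ := exists_ne (1 : Subgroup.center (Q ⧸ Subgroup.center Q))
  obtain ⟨a, rfl⟩ := QuotientGroup.mk_surjective x
  refine ⟨a, fun h => hx1 (Subtype.ext ((QuotientGroup.eq_one_iff a).2 h)), fun g => ?_⟩
  rw [← QuotientGroup.eq_one_iff]
  have := (Subgroup.mem_center_iff.1 hx) (g : Q ⧸ Subgroup.center Q)
  change ⁅(a : Q ⧸ Subgroup.center Q), (g : Q ⧸ Subgroup.center Q)⁆ = 1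
  rw [commutatorElement_eq_one_iff_mul_comm]
  exact this.symm

namespace Representation

variable {G V : Type*} [Group G] [AddCommGroup V] [Module ℂ V]

/-- An irreducible representation of degree `p` of a `p`-group has an abelian image of a subgroup
of index `p`. -/
theorem IsIrreducible.exists_index_eq_of_finrank_eq {p : ℕ} (hp : p.Prime) [Finite G]
    [FiniteDimensional ℂ V] (hG : IsPGroup p G) {ρ : Representation ℂ G V} (hρ : ρ.IsIrreducible)
    (hdim : Module.finrank ℂ V = p) :
    ∃ H : Subgroup G, H.index = p ∧ ⁅H, H⁆ ≤ MonoidHom.ker ρ := by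
  have : Fact p.Prime := ⟨hp⟩
  have := hρ.nontrivial_space
  set K := MonoidHom.ker ρ with hK
  have hc : Subgroup.center (G ⧸ K) ≠ ⊤ := by
    intro h
    have : commutator G ≤ K := by
      rw [commutator_def, Subgroup.commutator_le]
      intro g _ k _
      rw [← QuotientGroup.eq_one_iff]
      change ⁅(g : G ⧸ K), (k : G ⧸ K)⁆ = 1
      rw [commutatorElement_eq_one_iff_mul_comm]
      have hk : (k : G ⧸ K) ∈ Subgroup.center (G ⧸ K) := h ▸ Subgroup.mem_top _
      exact Subgroup.mem_center_iff.1 hk g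
    have := hρ.finrank_eq_one_of_commutator_le_ker this
    exact hp.one_lt.ne' (hdim ▸ this)
  obtain ⟨x, hx, hxc⟩ := (hG.to_quotient K).exists_commutator_mem_center hc
  obtain ⟨a, rfl⟩ := QuotientGroup.mk_surjective x
  -- The element `a` lies in the second centre modulo `K`, so `⁅a, g⁆` is central modulo `K` and
  -- Schur's lemma makes it a scalar.
  have hscal : ∀ g, ∃ c : ℂ, ∀ v, ρ ⁅a, g⁆ v = c • v := by
    intro g
    refine hρ.exists_eq_smul _ fun k => ρ.commute_of_commutator_mem_ker ?_
    change ⁅⁅a, g⁆, k⁆ ∈ K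
    rw [← QuotientGroup.eq_one_iff]
    change ⁅⁅(a : G ⧸ K), (g : G ⧸ K)⁆, (k : G ⧸ K)⁆ = 1
    rw [commutatorElement_eq_one_iff_mul_comm]
    exact (Subgroup.mem_center_iff.1 (hxc g) k).symm
  choose c hc using hscal
  have hag : ∀ g, ρ a * ρ g = c g • (ρ g * ρ a) := by
    intro g
    ext v
    have h1 : a * g = ⁅a, g⁆ * (g * a) := by group
    rw [← map_mul, h1, map_mul, Module.End.mul_apply, hc, map_mul, LinearMap.smul_apply]
  let H : Subgroup G :=
    { carrier := {g | Commute (ρ g) (ρ a)}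
      mul_mem' := fun {g k} hg hk => by
        change Commute (ρ (g * k)) (ρ a)
        rw [map_mul]; exact Commute.mul_left hg hk
      one_mem' := by change Commute (ρ 1) (ρ a); rw [map_one]; exact Commute.one_left _
      inv_mem' := fun {g} hg => by
        refine ρ.commute_of_commutator_mem_ker ?_
        have h1 : ⁅g⁻¹, a⁆ = g⁻¹ * ⁅g, a⁆⁻¹ * g⁻¹⁻¹ := by
          simp only [commutatorElement_def]; group
        rw [h1]
        exact (MonoidHom.normal_ker ρ).conj_mem _
          (inv_mem (ρ.commutator_mem_ker_of_commute hg)) _ }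
  have hHmem : ∀ g, g ∈ H ↔ Commute (ρ g) (ρ a) := fun g => Iff.rfl
  have hinv : ∀ g v, ρ g (ρ g⁻¹ v) = v := fun g v => by
    rw [← Module.End.mul_apply, ← map_mul, mul_inv_cancel, map_one, Module.End.one_apply]
  have hinv' : ∀ g v, ρ g⁻¹ (ρ g v) = v := fun g v => by
    rw [← Module.End.mul_apply, ← map_mul, inv_mul_cancel, map_one, Module.End.one_apply]
  -- cosets of `H` are separated by the scalars
  have hcinj : ∀ g k, c g = c k → g⁻¹ * k ∈ H := by
    intro g k hgk
    rw [hHmem, commute_iff_eq]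
    have hg : ∀ v, ρ a (ρ g v) = c g • ρ g (ρ a v) := fun v => congrArg (fun f => f v) (hag g)
    have hk : ∀ v, ρ a (ρ k v) = c g • ρ k (ρ a v) := fun v => by
      rw [hgk]; exact congrArg (fun f => f v) (hag k)
    have hc0 : c g ≠ 0 := by
      intro h0
      obtain ⟨v, hv⟩ := exists_ne (0 : V)
      have := hc g v
      rw [h0, zero_smul] at this
      apply hv
      rw [← hinv' ⁅a, g⁆ v, this, map_zero]
    ext v
    rw [map_mul]
    simp only [Module.End.mul_apply]
    have e1 := hg (ρ g⁻¹ (ρ k v))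
    rw [hinv, hk] at e1
    have e2 := smul_right_injective V hc0 e1
    rw [e2, hinv']
  obtain ⟨l, hl⟩ := Module.End.exists_eigenvalue (ρ a)
  obtain ⟨w, hw⟩ := hl.exists_hasEigenvector
  have hl0 : l ≠ 0 := by
    rintro rfl
    have := hw.apply_eq_smul
    rw [zero_smul] at this
    exact hw.2 (by rw [← hinv' a w, this, map_zero])
  have := Fintype.ofFinite (G ⧸ H)
  -- `ρ g` carries the eigenvector `w` of `ρ a` to one with eigenvalue `c g * l`. Different cosets
  -- of `H` give different eigenvalues, so the index of `H` is at most `p`; once it equals `p`, the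
  -- translates of `w` form an eigenbasis with distinct eigenvalues, in which all of `H` is
  -- diagonal.
  let μ : G ⧸ H → ℂ := fun q => c q.out * l
  have hμ : Function.Injective μ := by
    intro q r hqr
    have := hcinj _ _ (mul_right_cancel₀ hl0 hqr)
    rw [← q.out_eq', ← r.out_eq']
    exact QuotientGroup.eq.2 this
  have hvec : ∀ q : G ⧸ H, Module.End.HasEigenvector (ρ a) (μ q) (ρ q.out w) := by
    intro q
    refine ⟨Module.End.mem_eigenspace_iff.2 ?_, fun h => hw.2 ?_⟩
    · have := congrArg (fun f => f w) (hag q.out)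
      simp only [Module.End.mul_apply, LinearMap.smul_apply] at this
      rw [this, hw.apply_eq_smul, map_smul, smul_smul]
    · rw [← hinv' q.out w, h, map_zero]
  have hli := Module.End.eigenvectors_linearIndependent' (ρ a) μ hμ _ hvec
  have hle : H.index ≤ p := by
    have := hli.fintype_card_le_finrank
    rwa [hdim, ← Nat.card_eq_fintype_card] at this
  have hne : H.index ≠ 1 := by
    rw [Ne, Subgroup.index_eq_one]
    intro htop
    refine hx (Subgroup.mem_center_iff.2 fun y => ?_)
    obtain ⟨g, rfl⟩ := QuotientGroup.mk_surjective y
    rw [← commutatorElement_eq_one_iff_mul_comm]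
    exact (QuotientGroup.eq_one_iff _).2
      (ρ.commutator_mem_ker_of_commute ((hHmem g).1 (htop ▸ Subgroup.mem_top g)))
  have hidx : H.index = p := by
    obtain ⟨k, hk⟩ := hG.index H
    have hk0 : k ≠ 0 := by rintro rfl; exact hne (by simpa using hk)
    refine le_antisymm hle ?_
    rw [hk]
    exact Nat.le_self_pow hk0 p
  refine ⟨H, hidx, ?_⟩
  let B := basisOfLinearIndependentOfCardEqFinrank' _ hli (by
    rw [← Nat.card_eq_fintype_card, hdim]; exact hidx)
  rw [Subgroup.commutator_le]
  intro g hg k hk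
  refine ρ.commutator_mem_ker_of_commute
    (B.commute_of_injective_eigenvalues (ρ a) μ hμ (fun q => ?_) hg hk)
  simpa [B] using (hvec q).apply_eq_smul

/-- The subgroup of index `p` that is abelian modulo `ker ρ` is also abelian modulo any larger
kernel. -/
theorem IsIrreducible.finrank_le_of_ker_le {p : ℕ} (hp : p.Prime) [Finite G]
    [FiniteDimensional ℂ V] (hG : IsPGroup p G) {ρ : Representation ℂ G V} (hρ : ρ.IsIrreducible)
    (hdim : Module.finrank ℂ V = p) {W : Type*} [AddCommGroup W] [Module ℂ W]
    [FiniteDimensional ℂ W] {σ : Representation ℂ G W} (hσ : σ.IsIrreducible)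
    (hker : MonoidHom.ker ρ ≤ MonoidHom.ker σ) : Module.finrank ℂ W ≤ p := by
  obtain ⟨H, hH, hHc⟩ := hρ.exists_index_eq_of_finrank_eq hp hG hdim
  exact hH ▸ hσ.finrank_le_index H (hHc.trans hker)

/-! ### Separating elements from normal subgroups by irreducible characters -/

/-- Restricting to an irreducible constituent on which a given element acts nontrivially. -/
theorem exists_isIrreducible_of_notMem_ker [Finite G] (z : G) (d : ℕ) :
    ∀ (V : Type) (_ : AddCommGroup V) (_ : Module ℂ V) (_ : FiniteDimensional ℂ V)
      (ρ : Representation ℂ G V), Module.finrank ℂ V = d → z ∉ MonoidHom.ker ρ →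
    ∃ (W : Type) (_ : AddCommGroup W) (_ : Module ℂ W) (_ : FiniteDimensional ℂ W)
      (σ : Representation ℂ G W), σ.IsIrreducible ∧ MonoidHom.ker ρ ≤ MonoidHom.ker σ ∧
        z ∉ MonoidHom.ker σ := by
  induction d using Nat.strong_induction_on with
  | _ d ih =>
    intro V _ _ _ ρ hd hz
    by_cases hirr : ρ.IsIrreducible
    · exact ⟨V, _, _, inferInstance, ρ, hirr, le_rfl, hz⟩
    have hnt : Nontrivial (Subrepresentation ρ) := by
      refine ⟨⊥, ⊤, fun h => hz ?_⟩
      have h1 : (⊥ : Submodule ℂ V) = ⊤ := congrArg Subrepresentation.toSubmodule h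
      rw [MonoidHom.mem_ker]
      ext v
      have hv : ∀ v : V, v = 0 := fun v => by
        rw [← Submodule.mem_bot ℂ, h1]; exact Submodule.mem_top
      rw [hv (ρ z v), hv ((1 : Module.End ℂ V) v)]
    have : ∃ S : Subrepresentation ρ, S ≠ ⊥ ∧ S ≠ ⊤ := by
      by_contra! h
      exact hirr ⟨fun S => or_iff_not_imp_left.2 (h S)⟩
    obtain ⟨S, hS0, hS1⟩ := this
    have hstep : ∀ S : Subrepresentation ρ, S ≠ ⊤ → (∃ v ∈ S, ρ z v ≠ v) →
        ∃ (W : Type) (_ : AddCommGroup W) (_ : Module ℂ W) (_ : FiniteDimensional ℂ W)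
          (σ : Representation ℂ G W), σ.IsIrreducible ∧ MonoidHom.ker ρ ≤ MonoidHom.ker σ ∧
            z ∉ MonoidHom.ker σ := by
      rintro S hS ⟨v, hvS, hv⟩
      have hlt : S.toSubmodule < ⊤ := lt_top_iff_ne_top.2 fun h =>
        hS (Subrepresentation.toSubmodule_injective h)
      have hker : MonoidHom.ker ρ ≤ MonoidHom.ker S.toRepresentation := by
        intro g hg
        rw [MonoidHom.mem_ker] at hg ⊢
        ext u
        change ρ g u = u
        rw [hg, Module.End.one_apply]
      obtain ⟨W, i1, i2, i3, σ, h1, h2, h3⟩ := ih _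
        (hd ▸ Submodule.finrank_lt hlt.ne) S.toSubmodule _ _ inferInstance
        S.toRepresentation rfl (fun h => hv (by
          rw [MonoidHom.mem_ker] at h
          exact congrArg (fun f => ((f ⟨v, hvS⟩ : S.toSubmodule) : V)) h))
      exact ⟨W, i1, i2, i3, σ, h1, hker.trans h2, h3⟩
    -- By Maschke's theorem `S` has an invariant complement; `z` must act nontrivially on one of the
    -- two summands, both of smaller dimension.
    obtain ⟨T, hT⟩ := exists_isCompl S
    have hT1 : T ≠ ⊤ := by
      rintro rfl
      exact hS0 (by simpa using hT.inf_eq_bot)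
    by_cases hSz : ∃ v ∈ S, ρ z v ≠ v
    · exact hstep S hS1 hSz
    by_cases hTz : ∃ v ∈ T, ρ z v ≠ v
    · exact hstep T hT1 hTz
    push Not at hSz hTz
    refine absurd ?_ hz
    rw [MonoidHom.mem_ker]
    ext v
    have hv : v ∈ S.toSubmodule ⊔ T.toSubmodule := by
      rw [← Subrepresentation.toSubmodule_sup, hT.sup_eq_top]
      exact Submodule.mem_top
    obtain ⟨s, hs, t, ht, rfl⟩ := Submodule.mem_sup.1 hv
    rw [map_add, hSz s hs, hTz t ht, Module.End.one_apply]

/-- The irreducible characters of a finite group separate elements from normal subgroups. -/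
theorem exists_isIrreducible_le_ker [Finite G] (N : Subgroup G) [N.Normal] {z : G} (hz : z ∉ N) :
    ∃ (W : Type) (_ : AddCommGroup W) (_ : Module ℂ W) (_ : FiniteDimensional ℂ W)
      (σ : Representation ℂ G W), σ.IsIrreducible ∧ N ≤ MonoidHom.ker σ ∧
        z ∉ MonoidHom.ker σ := by
  -- The permutation representation on functions on `G ⧸ N` has kernel `N`. Numbering the cosets
  -- puts its space in `Type`, whatever the universe of `G`.
  let e := Finite.equivFin (G ⧸ N)
  let ρ : Representation ℂ G (Fin (Nat.card (G ⧸ N)) → ℂ) :=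
    { toFun := fun g => LinearMap.funLeft ℂ ℂ fun i => e (g⁻¹ • e.symm i)
      map_one' := by ext; simp [LinearMap.funLeft]
      map_mul' := fun g h => by ext; simp [LinearMap.funLeft, mul_smul] }
  have hρ : ∀ g f i, ρ g f i = f (e (g⁻¹ • e.symm i)) := fun g f i => rfl
  have hker : MonoidHom.ker ρ = N := by
    ext g
    rw [MonoidHom.mem_ker, ← inv_mem_iff (x := g)]
    constructor
    · intro h
      -- Testing on the indicator function of the trivial coset shows that `g⁻¹` fixes this coset.
      have h2 := congrFun (congrArg (fun f => f (Pi.single (e 1) 1)) h) (e 1)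
      rw [hρ, Module.End.one_apply, Pi.single_eq_same, Pi.single_apply] at h2
      have h3 : e (g⁻¹ • e.symm (e 1)) = e 1 := by
        by_contra h4
        rw [if_neg h4] at h2
        exact zero_ne_one h2
      rw [e.symm_apply_apply] at h3
      have h4 : ((g⁻¹ * 1 : G) : G ⧸ N) = 1 := e.injective h3
      rw [mul_one] at h4
      exact (QuotientGroup.eq_one_iff _).1 h4
    · intro h
      refine LinearMap.ext fun f => funext fun i => ?_
      rw [hρ, Module.End.one_apply]
      obtain ⟨x, hx⟩ := QuotientGroup.mk_surjective (e.symm i)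
      have h2 : ((g⁻¹ : G) : G ⧸ N) = 1 := (QuotientGroup.eq_one_iff _).2 h
      have h3 : g⁻¹ • e.symm i = e.symm i := by
        rw [← hx]
        change ((g⁻¹ * x : G) : G ⧸ N) = x
        rw [QuotientGroup.mk_mul, h2, one_mul]
      rw [h3, e.apply_symm_apply]
  obtain ⟨W, i1, i2, i3, σ, h1, h2, h3⟩ := exists_isIrreducible_of_notMem_ker z _ _ _ _
    inferInstance ρ rfl (by rwa [hker])
  exact ⟨W, i1, i2, i3, σ, h1, hker ▸ h2, h3⟩

end Representation

/-! ### The lower central series of a finite `p`-group -/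

namespace Subgroup

variable {G : Type*} [Group G]

/-- A nilpotent group whose abelianization is covered by a cyclic group is abelian. -/
theorem commutator_eq_bot_of_ker_le [Group.IsNilpotent G] {C : Type*} [Group C] [IsCyclic C]
    (f : G →* C) (hf : f.ker ≤ _root_.commutator G) : _root_.commutator G = ⊥ := by
  set L := (⊤ : Subgroup G).lowerCentralSeries 2 with hL
  have hcL : ⁅_root_.commutator G, (⊤ : Subgroup G)⁆ = L := rfl
  have hLf : L ≤ f.ker := by
    let _ : CommGroup C := IsCyclic.commGroup
    refine le_trans ?_ (Abelianization.commutator_subset_ker f)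
    exact (⊤ : Subgroup G).lowerCentralSeries_antitone (by norm_num : 1 ≤ 2)
  -- Modulo `L`, the third term of the series, the kernel of `f` is central, so `G ⧸ L` is abelian,
  -- being cyclic modulo a central subgroup. The series is then constant from the commutator
  -- subgroup on, and nilpotency makes it trivial.
  have hab : _root_.commutator G ≤ L := by
    rw [_root_.commutator_def, commutator_le]
    intro g _ k _
    rw [← QuotientGroup.eq_one_iff]
    change ⁅(g : G ⧸ L), (k : G ⧸ L)⁆ = 1
    rw [commutatorElement_eq_one_iff_mul_comm]
    refine ((QuotientGroup.lift L f
      hLf).isMulCommutative_of_isCyclic_of_ker_le_center ?_).is_comm.comm _ _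
    intro x hx
    obtain ⟨x, rfl⟩ := QuotientGroup.mk_surjective x
    refine mem_center_iff.2 fun y => ?_
    obtain ⟨y, rfl⟩ := QuotientGroup.mk_surjective y
    have hx' : x ∈ _root_.commutator G := hf hx
    symm
    rw [← commutatorElement_eq_one_iff_mul_comm]
    exact (QuotientGroup.eq_one_iff _).2 (hcL ▸ commutator_mem_commutator hx' (mem_top y))
  have hstab : ∀ k, _root_.commutator G ≤ (⊤ : Subgroup G).lowerCentralSeries (k + 1) := by
    intro k
    induction k with
    | zero => exact le_rfl
    | succ k ih => exact (hab.trans (le_of_eq hcL.symm)).trans (commutator_mono ih le_rfl)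
  obtain ⟨k, hk⟩ := nilpotent_iff_lowerCentralSeries.1 ‹Group.IsNilpotent G›
  rw [eq_bot_iff, ← hk]
  exact (hstab k).trans ((⊤ : Subgroup G).lowerCentralSeries_antitone k.le_succ)

theorem lowerCentralSeries_succ_lt [Group.IsNilpotent G] {i : ℕ}
    (h : (⊤ : Subgroup G).lowerCentralSeries i ≠ ⊥) :
    (⊤ : Subgroup G).lowerCentralSeries (i + 1) < (⊤ : Subgroup G).lowerCentralSeries i := by
  refine lt_of_le_of_ne ((⊤ : Subgroup G).lowerCentralSeries_antitone i.le_succ) fun heq => h ?_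
  have hstab : ∀ k, (⊤ : Subgroup G).lowerCentralSeries (i + k) =
      (⊤ : Subgroup G).lowerCentralSeries i := by
    intro k
    induction k with
    | zero => rfl
    | succ k ih =>
      rw [← add_assoc, lowerCentralSeries_succ, ih, ← lowerCentralSeries_succ, heq]
  obtain ⟨k, hk⟩ := nilpotent_iff_lowerCentralSeries.1 ‹Group.IsNilpotent G›
  rw [eq_bot_iff, ← hk, ← hstab k]
  exact (⊤ : Subgroup G).lowerCentralSeries_antitone (Nat.le_add_left _ _)

/-- Proper inclusions of subgroups of a `p`-group multiply the index by at least `p`. -/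
theorem index_pow_lt {p : ℕ} [Fact p.Prime] [Finite G] {H K : Subgroup G} (h : H < K)
    {a b : ℕ} (ha : K.index = p ^ a) (hb : H.index = p ^ b) : a < b := by
  have h1 := index_strictAnti h
  rw [ha, hb] at h1
  exact (Nat.pow_lt_pow_iff_right (Fact.out : p.Prime).one_lt).1 h1

/-- Otherwise the abelianization has order `1` or `p`, hence is cyclic, which forces a nilpotent
group to be abelian. -/
theorem two_le_of_index_commutator {p : ℕ} [Fact p.Prime] [Finite G] (hG : IsPGroup p G)
    (h : _root_.commutator G ≠ ⊥) {e : ℕ} (he : (_root_.commutator G).index = p ^ e) : 2 ≤ e := by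
  by_contra! hlt
  have := hG.isNilpotent
  have hcard : Nat.card (G ⧸ _root_.commutator G) = p ^ e := he
  have : IsCyclic (G ⧸ _root_.commutator G) := by
    interval_cases e
    · have : Subsingleton (G ⧸ _root_.commutator G) :=
        (Nat.card_eq_one_iff_unique.1 (by simpa using hcard)).1
      infer_instance
    · exact isCyclic_of_prime_card (p := p) (by simpa using hcard)
  exact h (commutator_eq_bot_of_ker_le (QuotientGroup.mk' (_root_.commutator G))
    (QuotientGroup.ker_mk' _).le)

/-- The first step of the series costs a factor of at least `p ^ 2`, and each later strict step at
least `p`. -/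
theorem lt_of_index_lowerCentralSeries {p : ℕ} [Fact p.Prime] [Finite G] (hG : IsPGroup p G)
    (i : ℕ) (h : (⊤ : Subgroup G).lowerCentralSeries (i + 1) ≠ ⊥) {e : ℕ}
    (he : ((⊤ : Subgroup G).lowerCentralSeries (i + 1)).index = p ^ e) : i + 2 ≤ e := by
  have := hG.isNilpotent
  induction i generalizing e with
  | zero => exact two_le_of_index_commutator hG h he
  | succ i ih =>
    have h' : (⊤ : Subgroup G).lowerCentralSeries (i + 1) ≠ ⊥ := fun h0 => h <| by
      rw [eq_bot_iff, ← h0]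
      exact (⊤ : Subgroup G).lowerCentralSeries_antitone (Nat.le_succ _)
    obtain ⟨d, hd⟩ := hG.index ((⊤ : Subgroup G).lowerCentralSeries (i + 1))
    have h1 := ih h' hd
    have h2 := index_pow_lt (lowerCentralSeries_succ_lt h') hd he
    omega

/-- A group of order `p ^ m` with `m ≥ 2` has class at most `m - 1`. -/
theorem lowerCentralSeries_eq_bot_of_card {p : ℕ} [Fact p.Prime] [Finite G] {m : ℕ} (hm : 2 ≤ m)
    (hcard : Nat.card G = p ^ m) : (⊤ : Subgroup G).lowerCentralSeries (m - 1) = ⊥ := by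
  have hG : IsPGroup p G := IsPGroup.of_card hcard
  by_contra h
  obtain ⟨e, he⟩ := hG.index ((⊤ : Subgroup G).lowerCentralSeries (m - 1))
  obtain ⟨j, rfl⟩ : ∃ j, m = j + 2 := ⟨m - 2, by omega⟩
  have h1 := lt_of_index_lowerCentralSeries hG j h he
  have h2 := index_pow_lt (bot_lt_iff_ne_bot.2 h) he (by rw [index_bot, hcard])
  omega

end Subgroup

/-! ### Normal subgroups of groups of maximal class -/

namespace IsMaximalClassPGroup

open Subgroup

variable {G : Type*} [Group G] [Finite G] {p n : ℕ}

theorem lowerCentralSeries_ne_bot (hp : p.Prime) (hG : IsMaximalClassPGroup p G)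
    (hcard : Nat.card G = p ^ n) {i : ℕ} (hi : i + 1 < n) :
    (⊤ : Subgroup G).lowerCentralSeries i ≠ ⊥ := by
  have : Fact p.Prime := ⟨hp⟩
  have := (IsPGroup.of_card hcard).isNilpotent
  obtain ⟨k, _, hk, hcl⟩ := hG
  obtain rfl : k = n := Nat.pow_right_injective hp.two_le (hk.symm.trans hcard)
  rw [Ne, Subgroup.lowerCentralSeries_eq_bot_iff_nilpotencyClass_le, hcl]
  omega

/-- Strict inclusions are counted from both ends: from the top they bound the exponent below by `m`,
from the bottom above by `m`. The order `p ^ n` leaves room for nothing else. -/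
theorem index_lowerCentralSeries (hp : p.Prime) (hG : IsMaximalClassPGroup p G)
    (hcard : Nat.card G = p ^ n) {m : ℕ} (hm : 2 ≤ m) (hmn : m ≤ n) :
    ((⊤ : Subgroup G).lowerCentralSeries (m - 1)).index = p ^ m := by
  have : Fact p.Prime := ⟨hp⟩
  have hP : IsPGroup p G := IsPGroup.of_card hcard
  have := hP.isNilpotent
  -- Here `j` counts the steps upwards from the term `n - 1`.
  have upper : ∀ j e, j + 2 ≤ n →
      ((⊤ : Subgroup G).lowerCentralSeries (n - 1 - j)).index = p ^ e → e + j ≤ n := by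
    intro j
    induction j with
    | zero =>
      intro e _ he
      have h1 : p ^ e ∣ p ^ n := by rw [← he, ← hcard]; exact index_dvd_card _
      exact (Nat.pow_dvd_pow_iff_le_right hp.one_lt).1 h1
    | succ j ih =>
      intro e hj he
      obtain ⟨d, hd⟩ := hP.index ((⊤ : Subgroup G).lowerCentralSeries (n - 1 - j))
      have h1 := ih d (by omega) hd
      have h2 := lowerCentralSeries_succ_lt
        (hG.lowerCentralSeries_ne_bot hp hcard (i := n - 1 - (j + 1)) (by omega))
      rw [show n - 1 - (j + 1) + 1 = n - 1 - j by omega] at h2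
      have h3 := index_pow_lt h2 he hd
      omega
  obtain ⟨e, he⟩ := hP.index ((⊤ : Subgroup G).lowerCentralSeries (m - 1))
  have h1 := upper (n - m) e (by omega) (by rwa [show n - 1 - (n - m) = m - 1 by omega])
  suffices m ≤ e by rw [he, show e = m by omega]
  -- The lower bound applies only to nontrivial terms; for `m = n` the term is trivial and its index
  -- is the order of `G`.
  rcases hmn.eq_or_lt with rfl | hlt
  · have hbot := lowerCentralSeries_eq_bot_of_card hm hcard
    rw [hbot, index_bot, hcard] at he
    exact (Nat.pow_right_injective hp.two_le he).le
  · obtain ⟨i, rfl⟩ : ∃ i, m = i + 2 := ⟨m - 2, by omega⟩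
    exact lt_of_index_lowerCentralSeries hP i
      (hG.lowerCentralSeries_ne_bot hp hcard (by omega)) he

/-- In a group of maximal class the normal subgroups of index at least `p ^ 2` are terms of the
lower central series. -/
theorem eq_lowerCentralSeries (hp : p.Prime) (hG : IsMaximalClassPGroup p G)
    (hcard : Nat.card G = p ^ n) (N : Subgroup G) [N.Normal] {m : ℕ} (hm : 2 ≤ m)
    (hN : N.index = p ^ m) : N = (⊤ : Subgroup G).lowerCentralSeries (m - 1) := by
  have : Fact p.Prime := ⟨hp⟩
  have hmn : m ≤ n := by
    have h1 : p ^ m ∣ p ^ n := by rw [← hN, ← hcard]; exact index_dvd_card _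
    exact (Nat.pow_dvd_pow_iff_le_right hp.one_lt).1 h1
  -- The quotient `G ⧸ N` has order `p ^ m`, hence class at most `m - 1`. Equality of indices then
  -- gives equality of subgroups.
  have hle : (⊤ : Subgroup G).lowerCentralSeries (m - 1) ≤ N := by
    have h1 := lowerCentralSeries_eq_bot_of_card (G := G ⧸ N) hm hN
    have h2 := map_lowerCentralSeries (⊤ : Subgroup G) (QuotientGroup.mk' N) (m - 1)
    rw [map_top_of_surjective _ (QuotientGroup.mk'_surjective N), h1,
      Subgroup.map_eq_bot_iff, QuotientGroup.ker_mk'] at h2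
    exact h2
  refine (hle.eq_of_not_lt fun hlt => ?_).symm
  exact lt_irrefl _ (index_pow_lt hlt hN (hG.index_lowerCentralSeries hp hcard hm hmn))

/-- Index `p ^ 2` makes `N` the commutator subgroup itself; for smaller index the quotient is
cyclic. -/
theorem commutator_le_of_index (hp : p.Prime) (hG : IsMaximalClassPGroup p G)
    (hcard : Nat.card G = p ^ n) (N : Subgroup G) [N.Normal] {m : ℕ} (hm : m ≤ 2)
    (hN : N.index = p ^ m) : _root_.commutator G ≤ N := by
  have : Fact p.Prime := ⟨hp⟩
  rcases hm.eq_or_lt with rfl | hlt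
  · exact (hG.eq_lowerCentralSeries hp hcard N le_rfl hN).ge
  have hcyc : IsCyclic (G ⧸ N) := by
    have hc : Nat.card (G ⧸ N) = p ^ m := hN
    interval_cases m
    · have : Subsingleton (G ⧸ N) := (Nat.card_eq_one_iff_unique.1 (by simpa using hc)).1
      infer_instance
    · exact isCyclic_of_prime_card (p := p) (by simpa using hc)
  let _ : CommGroup (G ⧸ N) := IsCyclic.commGroup
  have := Abelianization.commutator_subset_ker (QuotientGroup.mk' N)
  rwa [QuotientGroup.ker_mk'] at this

end IsMaximalClassPGroup

/-! ### Kernels of irreducible characters in groups of maximal class -/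

namespace IsMaximalClassPGroup

open Representation

variable {G : Type*} [Group G] [Finite G] {p n : ℕ} {V : Type*} [AddCommGroup V] [Module ℂ V]

/-- The kernel of a linear character of a nonabelian group of maximal class has index `1` or `p`. -/
theorem index_ker_of_finrank_eq_one (hp : p.Prime) (hG : IsMaximalClassPGroup p G)
    (hcard : Nat.card G = p ^ n) (hn : 3 ≤ n) (ρ : Representation ℂ G V)
    (hdim : Module.finrank ℂ V = 1) : ∃ k ≤ 1, (MonoidHom.ker ρ).index = p ^ k := by
  have : Fact p.Prime := ⟨hp⟩
  have hP : IsPGroup p G := IsPGroup.of_card hcard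
  have := hP.isNilpotent
  obtain ⟨k, hk⟩ := hP.index (MonoidHom.ker ρ)
  refine ⟨k, ?_, hk⟩
  by_contra! hk1
  have hker := hG.eq_lowerCentralSeries hp hcard (MonoidHom.ker ρ) hk1 hk
  have hle : MonoidHom.ker ρ ≤ commutator G := by
    rw [hker]
    exact (⊤ : Subgroup G).lowerCentralSeries_antitone (by omega : 1 ≤ k - 1)
  -- On a line the determinant is the scalar by which `g` acts. A finite subgroup of `ℂˣ` is cyclic,
  -- so a kernel inside the commutator subgroup would make `G` abelian.
  let f : G →* ℂˣ := ((LinearMap.det : Module.End ℂ V →* ℂ).comp ρ).toHomUnits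
  have hf : f.ker ≤ MonoidHom.ker ρ := by
    intro g hg
    have h1 : LinearMap.det (ρ g) = 1 := congrArg Units.val (MonoidHom.mem_ker.1 hg)
    obtain ⟨a, ha, -⟩ := LinearMap.existsUnique_eq_smul_id_of_finrank_eq_one hdim (ρ g)
    rw [ha, LinearMap.det_smul, hdim, pow_one, LinearMap.det_id, mul_one] at h1
    rw [MonoidHom.mem_ker, ha, h1, one_smul]
    rfl
  refine hG.lowerCentralSeries_ne_bot hp hcard (i := 1) (by omega) ?_
  have : Finite f.range := (Set.finite_range f).to_subtype
  refine Subgroup.commutator_eq_bot_of_ker_le f.rangeRestrict ?_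
  rw [MonoidHom.ker_rangeRestrict]
  exact hf.trans hle

/-- The kernel of a nonlinear irreducible character of a group of maximal class. -/
theorem exists_ker_eq_lowerCentralSeries [FiniteDimensional ℂ V] (hp : p.Prime)
    (hG : IsMaximalClassPGroup p G) (hcard : Nat.card G = p ^ n) {ρ : Representation ℂ G V}
    (hρ : ρ.IsIrreducible) (hdim : Module.finrank ℂ V ≠ 1) :
    ∃ m, 3 ≤ m ∧ m ≤ n ∧ MonoidHom.ker ρ = (⊤ : Subgroup G).lowerCentralSeries (m - 1) ∧
      (MonoidHom.ker ρ).index = p ^ m := by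
  have : Fact p.Prime := ⟨hp⟩
  obtain ⟨m, hm⟩ := (IsPGroup.of_card hcard : IsPGroup p G).index (MonoidHom.ker ρ)
  have h3 : 3 ≤ m := by
    by_contra! h
    exact hdim (hρ.finrank_eq_one_of_commutator_le_ker
      (hG.commutator_le_of_index hp hcard _ (by omega) hm))
  refine ⟨m, h3, ?_, hG.eq_lowerCentralSeries hp hcard _ (by omega) hm, hm⟩
  have h1 : p ^ m ∣ p ^ n := by rw [← hm, ← hcard]; exact Subgroup.index_dvd_card _
  exact (Nat.pow_dvd_pow_iff_le_right hp.one_lt).1 h1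

/-- Supplies the codegree `p`: a nontrivial character of the abelianization cannot have kernel of
index `1`. -/
theorem exists_finrank_eq_one_index_ker_eq (hp : p.Prime)
    (hG : IsMaximalClassPGroup p G) (hcard : Nat.card G = p ^ n) (hn : 3 ≤ n) :
    ∃ (W : Type) (_ : AddCommGroup W) (_ : Module ℂ W) (_ : FiniteDimensional ℂ W)
      (σ : Representation ℂ G W), σ.IsIrreducible ∧ Module.finrank ℂ W = 1 ∧
        (MonoidHom.ker σ).index = p ^ 1 := by
  have hidx := hG.index_lowerCentralSeries hp hcard le_rfl (by omega : 2 ≤ n)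
  have htop : commutator G ≠ ⊤ := by
    intro h
    change (commutator G).index = p ^ 2 at hidx
    rw [h, Subgroup.index_top] at hidx
    exact (Nat.one_lt_pow two_ne_zero hp.one_lt).ne hidx
  obtain ⟨z, hz⟩ : ∃ z, z ∉ commutator G := by
    by_contra! h
    exact htop (eq_top_iff.2 fun g _ => h g)
  obtain ⟨W, i1, i2, i3, σ, hσ, hle, hzσ⟩ := exists_isIrreducible_le_ker _ hz
  have hdim := hσ.finrank_eq_one_of_commutator_le_ker hle
  refine ⟨W, i1, i2, i3, σ, hσ, hdim, ?_⟩
  obtain ⟨k, hk, hki⟩ := hG.index_ker_of_finrank_eq_one hp hcard hn σ hdim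
  interval_cases k
  · rw [pow_zero, Subgroup.index_eq_one] at hki
    exact absurd (hki ▸ Subgroup.mem_top z) hzσ
  · exact hki

/-- Separate some `z` in the term `m - 2` of the series from the term `m - 1`. As `m ≥ 3`, `z` is in
the commutator subgroup, so the character is nonlinear. Its kernel is a term of the series
containing the term `m - 1` but not the term `m - 2`. -/
theorem exists_isIrreducible_index_ker_eq (hp : p.Prime)
    (hG : IsMaximalClassPGroup p G) (hcard : Nat.card G = p ^ n) {m : ℕ} (hm : 3 ≤ m)
    (hmn : m ≤ n) :
    ∃ (W : Type) (_ : AddCommGroup W) (_ : Module ℂ W) (_ : FiniteDimensional ℂ W)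
      (σ : Representation ℂ G W), σ.IsIrreducible ∧ Module.finrank ℂ W ≠ 1 ∧
        (MonoidHom.ker σ).index = p ^ m := by
  have : Fact p.Prime := ⟨hp⟩
  have := (IsPGroup.of_card hcard : IsPGroup p G).isNilpotent
  have hlt := Subgroup.lowerCentralSeries_succ_lt
    (hG.lowerCentralSeries_ne_bot hp hcard (i := m - 2) (by omega))
  rw [show m - 2 + 1 = m - 1 by omega] at hlt
  obtain ⟨z, hz, hz'⟩ := SetLike.exists_of_lt hlt
  obtain ⟨W, i1, i2, i3, σ, hσ, hle, hzσ⟩ := exists_isIrreducible_le_ker _ hz'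
  have hdim : Module.finrank ℂ W ≠ 1 := fun h => hzσ <|
    σ.commutator_le_ker_of_finrank_eq_one h <|
      (⊤ : Subgroup G).lowerCentralSeries_antitone (by omega : 1 ≤ m - 2) hz
  refine ⟨W, i1, i2, i3, σ, hσ, hdim, ?_⟩
  obtain ⟨k, hk3, hkn, hker, hidx⟩ := hG.exists_ker_eq_lowerCentralSeries hp hcard hσ hdim
  rcases lt_trichotomy k m with h | rfl | h
  · refine absurd ?_ hzσ
    rw [hker]
    exact (⊤ : Subgroup G).lowerCentralSeries_antitone (by omega : k - 1 ≤ m - 2) hz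
  · exact hidx
  · have h1 := Subgroup.index_antitone hle
    rw [hidx, hG.index_lowerCentralSeries hp hcard (by omega) hmn] at h1
    exact absurd ((Nat.pow_le_pow_iff_right hp.one_lt).1 h1) (by omega)

/-- Kernels of nonlinear characters form a chain, so comparing their indices amounts to comparing
the kernels. -/
theorem finrank_le_of_index_ker_le [FiniteDimensional ℂ V] (hp : p.Prime)
    (hG : IsMaximalClassPGroup p G) (hcard : Nat.card G = p ^ n)
    {ρ : Representation ℂ G V} (hρ : ρ.IsIrreducible) (hdim : Module.finrank ℂ V = p)
    {W : Type*} [AddCommGroup W] [Module ℂ W] [FiniteDimensional ℂ W] {σ : Representation ℂ G W}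
    (hσ : σ.IsIrreducible) (hker : (MonoidHom.ker σ).index ≤ (MonoidHom.ker ρ).index) :
    Module.finrank ℂ W ≤ p := by
  by_cases h1 : Module.finrank ℂ W = 1
  · exact h1 ▸ hp.one_lt.le
  obtain ⟨k, hk3, hkn, hk, hki⟩ := hG.exists_ker_eq_lowerCentralSeries hp hcard hσ h1
  obtain ⟨m, hm3, hmn, hm, hmi⟩ := hG.exists_ker_eq_lowerCentralSeries hp hcard hρ
    (hdim ▸ hp.one_lt.ne')
  refine hρ.finrank_le_of_ker_le hp (IsPGroup.of_card hcard) hdim hσ ?_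
  rw [hki, hmi] at hker
  have := (Nat.pow_le_pow_iff_right hp.one_lt).1 hker
  rw [hk, hm]
  exact (⊤ : Subgroup G).lowerCentralSeries_antitone (by omega)

end IsMaximalClassPGroup

/-! ### Codegrees and the main theorem -/

theorem Representation.isIrreducible_trivial {G : Type*} [Group G] :
    (Representation.trivial ℂ G ℂ).IsIrreducible where
  exists_pair_ne := ⟨⊥, ⊤, fun h =>
    bot_ne_top (α := Submodule ℂ ℂ) (congrArg Subrepresentation.toSubmodule h)⟩
  eq_bot_or_eq_top S := (eq_bot_or_eq_top S.toSubmodule).imp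
    (fun h => Subrepresentation.toSubmodule_injective h)
    (fun h => Subrepresentation.toSubmodule_injective h)

theorem Representation.codegree_eq_pow {G V : Type*} [Group G] [AddCommGroup V] [Module ℂ V]
    {ρ : Representation ℂ G V} {p m e : ℕ} (hp : p.Prime) (hidx : (MonoidHom.ker ρ).index = p ^ m)
    (hdim : Module.finrank ℂ V = p ^ e) (h : e ≤ m) : ρ.codegree = (p : ℚ) ^ (m - e) := by
  have hp0 : (p : ℚ) ≠ 0 := by exact_mod_cast hp.ne_zero
  rw [Representation.codegree, hidx, hdim, pow_sub₀ _ hp0 h, div_eq_mul_inv]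
  push_cast
  rfl

open Representation in
theorem theoremB (p n b : ℕ) (hp : p.Prime) (hb : 2 ≤ b)
    (G : Type*) [Group G] [Finite G]
    (hG : IsMaximalClassPGroup p G)
    (hcard : Nat.card G = p ^ n)
    (hcd : characterDegrees G = {1, p, p ^ b}) :
    ∃ c : ℕ, (n : ℤ) - (b : ℤ) ≤ (c : ℤ) ∧ (c : ℤ) ≤ (n : ℤ) - 2 ∧
      characterCodegrees G = {q : ℚ | ∃ i : ℕ, i ≤ c ∧ q = (p : ℚ) ^ i} := by
  have hp1 := hp.one_lt
  have hpb : p < p ^ b := by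
    simpa using (Nat.pow_lt_pow_iff_right (m := b) hp1).2 (show 1 < b by omega)
  let P : ℕ → Prop := fun m => ∃ (V : Type) (_ : AddCommGroup V) (_ : Module ℂ V)
    (_ : FiniteDimensional ℂ V) (ρ : Representation ℂ G V), ρ.IsIrreducible ∧
      Module.finrank ℂ V = p ∧ (MonoidHom.ker ρ).index = p ^ m
  -- the largest `M` such that the quotient of order `p ^ M` has a faithful character of degree `p`
  obtain ⟨M, hM3, hMn, hPM, hMmax⟩ : ∃ M, 3 ≤ M ∧ M ≤ n ∧ P M ∧ ∀ m ≤ n, P m → m ≤ M := by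
    classical
    have hmem : p ∈ characterDegrees G := by simp [hcd]
    obtain ⟨V, i1, i2, i3, ρ, hρ, hV⟩ := hmem
    obtain ⟨k, hk3, hkn, -, hk⟩ := hG.exists_ker_eq_lowerCentralSeries hp hcard hρ
      (hV ▸ hp1.ne')
    have hPk : P k := ⟨V, i1, i2, i3, ρ, hρ, hV.symm, hk⟩
    exact ⟨Nat.findGreatest P n, hk3.trans (Nat.le_findGreatest hkn hPk),
      Nat.findGreatest_le n, Nat.findGreatest_spec hkn hPk,
      fun m hm h => Nat.le_findGreatest hm h⟩
  obtain ⟨V, i1, i2, i3, ρ, hρ, hV, hρM⟩ := hPM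
  have hsmall : ∀ (W : Type) (_ : AddCommGroup W) (_ : Module ℂ W) (_ : FiniteDimensional ℂ W)
      (σ : Representation ℂ G W) (m : ℕ), σ.IsIrreducible → (MonoidHom.ker σ).index = p ^ m →
      m ≤ M → Module.finrank ℂ W ≤ p := by
    intro W _ _ _ σ m hσ hm hmM
    refine hG.finrank_le_of_index_ker_le hp hcard hρ hV hσ ?_
    rw [hm, hρM]
    exact Nat.pow_le_pow_right hp.pos hmM
  have hdeg : ∀ (W : Type) (_ : AddCommGroup W) (_ : Module ℂ W) (_ : FiniteDimensional ℂ W)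
      (σ : Representation ℂ G W), σ.IsIrreducible →
      Module.finrank ℂ W = 1 ∨ Module.finrank ℂ W = p ∨ Module.finrank ℂ W = p ^ b := by
    intro W i1 i2 i3 σ hσ
    have : Module.finrank ℂ W ∈ characterDegrees G := ⟨W, i1, i2, i3, σ, hσ, rfl⟩
    simpa [hcd] using this
  -- The kernel acts trivially, so its index bounds the degree. This keeps the truncated
  -- subtractions `k - b` and `n - b` below exact.
  have hbm : ∀ (W : Type) (_ : AddCommGroup W) (_ : Module ℂ W) (_ : FiniteDimensional ℂ W)
      (σ : Representation ℂ G W) (m : ℕ), σ.IsIrreducible → (MonoidHom.ker σ).index = p ^ m →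
      Module.finrank ℂ W = p ^ b → b ≤ m := by
    intro W _ _ _ σ m hσ hm hW
    have := hσ.finrank_le_index (MonoidHom.ker σ) (Subgroup.commutator_le_left _ _)
    rw [hm, hW] at this
    exact (Nat.pow_le_pow_iff_right hp1).1 this
  -- A character of degree `p ^ b > p` has kernel of index `p ^ k` with `M < k ≤ n`.
  have hMlt : M < n ∧ b ≤ n := by
    have hmem : p ^ b ∈ characterDegrees G := by simp [hcd]
    obtain ⟨W, j1, j2, j3, σ, hσ, hW⟩ := hmem
    obtain ⟨k, hk3, hkn, -, hk⟩ := hG.exists_ker_eq_lowerCentralSeries hp hcard hσ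
      (by rw [← hW]; omega)
    have h1 := hbm W j1 j2 j3 σ k hσ hk hW.symm
    have h2 := hsmall W j1 j2 j3 σ k hσ hk
    omega
  -- The largest codegree of a character of degree `p` is `p ^ (M - 1)`, and of one of degree `p ^
  -- b` it is `p ^ (n - b)`.
  refine ⟨max (M - 1) (n - b), by omega, by omega, Set.ext fun q => ⟨?_, ?_⟩⟩
  · rintro ⟨W, j1, j2, j3, σ, hσ, rfl⟩
    by_cases h1 : Module.finrank ℂ W = 1
    · obtain ⟨k, hk1, hk⟩ := hG.index_ker_of_finrank_eq_one hp hcard (by omega) σ h1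
      exact ⟨k - 0, by omega, codegree_eq_pow hp hk (by simpa using h1) k.zero_le⟩
    obtain ⟨k, hk3, hkn, -, hk⟩ := hG.exists_ker_eq_lowerCentralSeries hp hcard hσ h1
    rcases (hdeg W j1 j2 j3 σ hσ).resolve_left h1 with h | h
    · have := hMmax k hkn ⟨W, j1, j2, j3, σ, hσ, h, hk⟩
      exact ⟨k - 1, by omega, codegree_eq_pow hp hk (by simpa using h) (by omega)⟩
    · exact ⟨k - b, by omega, codegree_eq_pow hp hk h (hbm W j1 j2 j3 σ k hσ hk h)⟩
  · rintro ⟨i, hi, rfl⟩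
    obtain rfl | rfl | hi2 : i = 0 ∨ i = 1 ∨ 2 ≤ i := by omega
    · refine ⟨ℂ, _, _, inferInstance, trivial ℂ G ℂ, isIrreducible_trivial, ?_⟩
      have hidx : (MonoidHom.ker (trivial ℂ G ℂ)).index = p ^ 0 := by
        rw [pow_zero, Subgroup.index_eq_one]
        exact eq_top_iff.2 fun g _ => rfl
      exact (codegree_eq_pow (e := 0) hp hidx (by simp) le_rfl).symm
    · obtain ⟨W, j1, j2, j3, σ, hσ, hW, hidx⟩ := hG.exists_finrank_eq_one_index_ker_eq hp hcard
        (by omega)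
      exact ⟨W, j1, j2, j3, σ, hσ, (codegree_eq_pow (e := 0) hp hidx (by simpa using hW) (Nat.zero_le 1)).symm⟩
    -- The exponent `i` comes from kernel index `p ^ (i + 1)` and degree `p` when `i + 1 ≤ M`.
    by_cases hiM : i + 1 ≤ M
    · obtain ⟨W, j1, j2, j3, σ, hσ, hW, hidx⟩ :=
        hG.exists_isIrreducible_index_ker_eq hp hcard (show 3 ≤ i + 1 by omega) (by omega)
      have h1 := hsmall W j1 j2 j3 σ _ hσ hidx hiM
      have h2 : Module.finrank ℂ W = p ^ 1 := by
        have := hdeg W j1 j2 j3 σ hσ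
        rw [pow_one]; omega
      exact ⟨W, j1, j2, j3, σ, hσ, (codegree_eq_pow hp hidx h2 (by omega)).symm⟩
    -- Now `i ≥ M`, so `i ≤ c` forces `i ≤ n - b`. Thus `M < i + b ≤ n`, and maximality of `M`
    -- excludes degree `p` for kernel index `p ^ (i + b)`.
    · obtain ⟨W, j1, j2, j3, σ, hσ, hW, hidx⟩ :=
        hG.exists_isIrreducible_index_ker_eq hp hcard (show 3 ≤ i + b by omega) (by omega)
      have h2 : Module.finrank ℂ W = p ^ b := by
        refine ((hdeg W j1 j2 j3 σ hσ).resolve_left hW).resolve_left fun h => ?_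
        have := hMmax (i + b) (by omega) ⟨W, j1, j2, j3, σ, hσ, h, hidx⟩
        omega
      have := codegree_eq_pow hp hidx h2 (by omega)
      rw [Nat.add_sub_cancel] at this
      exact ⟨W, j1, j2, j3, σ, hσ, this.symm⟩
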